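/- All graphs are finite and simple; $e(G)$ is the number of edges of $G$, and $T_r(m)$ is the Turán graph, i.e. the $m$-vertex complete $r$-partite graph with parts as balanced as possible. A graph is traceable if it contains a Hamiltonian path. A graph is $k$-path Hamiltonian if every path of length at most $k$ in it (a single vertex being a path of length $0$) is contained in a Hamiltonian cycle. Let $\mathcal J^k_{n,r}$ be the set of $n$-vertex, $K_{r+1}$-free graphs consisting of $T_r(n-1)$ plus one vertex of degree $k+1$ whose neighbourhood induces a traceable graph. Let $r\ge 3$ and $k\ge 0$ be integers and let $G$ be an $n$-vertex, $K_{r+1}$-free graph. (1) Suppose that $n\ge 6k+26$ if $r=3$, $n\ge 5k+11$ if $4\le r\le 7$, and $n\ge 2k+9$ if $r\ge 8$. If $G$ is not $k$-path Hamiltonian, then $$e(G)\le e(T_r(n-1))+k+1 .$$ If $G\in\mathcal J^k_{n,r}$, then $G$ is not $k$-path Hamiltonian and equality holds. (2) Suppose that $n\ge 6k+26$ if $r=3$, $n\ge 6k+2r+3$ if $4\le r\le 7$, and $n\ge 2k+2r$ if $r\ge 8$. If $G$ is not $k$-path Hamiltonian, then $e(G)\le e(T_r(n-1))+k+1$. Moreover,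 $G$ is not $k$-path Hamiltonian and satisfies $e(G)=e(T_r(n-1))+k+1$ if and only if $G\in\mathcal J^k_{n,r}$, or $(k,r,n)=(0,4,11)$ and $G\cong K_{6,2,2,1}$. -/

import Mathlib

namespace SimpleGraph

/-- A graph is traceable if it contains a Hamiltonian path. -/
def Traceable {V : Type*} [DecidableEq V] (G : SimpleGraph V) : Prop :=
  ∃ (a b : V) (p : G.Walk a b), p.IsHamiltonian

/-- A graph is `k`-path Hamiltonian if every path of length at most `k` is contained
(as a subgraph) in a Hamiltonian cycle. -/
def IsPathHamiltonian {V : Type*} [DecidableEq V] (G : SimpleGraph V) (k : ℕ) : Prop :=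
  ∀ (u v : V) (p : G.Walk u v), p.IsPath → p.length ≤ k →
    ∃ (a : V) (c : G.Walk a a), c.IsHamiltonianCycle ∧ p.toSubgraph ≤ c.toSubgraph

/-- Membership in the family of `n`-vertex, `K_{r+1}`-free graphs consisting of the Turán graph
`T_r(n-1)` plus one vertex of degree `k+1` whose neighbourhood induces a traceable graph. -/
def IsTuranPlusTraceableVertex {V : Type*} [Fintype V] [DecidableEq V] (G : SimpleGraph V)
    [DecidableRel G.Adj] (n r k : ℕ) : Prop :=
  Fintype.card V = n ∧ G.CliqueFree (r + 1) ∧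
    ∃ v : V, Nonempty (G.induce ({v}ᶜ : Set V) ≃g turanGraph (n - 1) r) ∧
      G.degree v = k + 1 ∧ (G.induce (G.neighborSet v)).Traceable

/-- The complete multipartite graph `K_{6,2,2,1}`. -/
abbrev K6221 : SimpleGraph (Σ i : Fin 4, Fin (![6, 2, 2, 1] i)) :=
  completeMultipartiteGraph fun i : Fin 4 => Fin (![6, 2, 2, 1] i)

end SimpleGraph

/-! If `G` is not `k`-path Hamiltonian, some path with edge set `F`, `#F ≤ k`, lies in no
Hamiltonian cycle. In an edge-maximal supergraph `H` with this defect, Ore's crossing argument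
bounds the degree sum of nonadjacent vertices by n + k - 1 (`exists_le_degree_add_degree_le`). An
extremal nonadjacent pair then gives a Chvátal condition: for some i, at least i - k vertices have
degree at most i (`exists_degree_le_of_not_isPathHamiltonian`).

If i ≤ k + 1, delete one vertex of degree at most k + 1 and apply Turán's theorem. Otherwise i = s +
k with s ≥ 2. Deleting s vertices of degree at most s + k and comparing Turán numbers suffices for r
≥ 4. For r = 3 and large s this is too lossy, and a Motzkin–Straus weighting replaces the deletion.

Equality in the first case makes G - u a Turán graph and H - u complete; the bad path must then span
N(u), which gives traceability. The second case is strict apart from one numerical tie, (r, k, n, s)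
= (4, 0, 11, 5), where equality throughout forces K_{6,2,2,1}. Conversely, a path spanning N(v) can
only be closed up through v, too early to be Hamiltonian. -/

namespace SimpleGraph
open Finset

/-! ### Arithmetic of Turán numbers -/

/-- Adding a vertex to the Turán graph `T_r(m)` adds `m - ⌊m / r⌋` edges. -/
lemma card_edgeFinset_turanGraph_succ {r : ℕ} (hr : 0 < r) (m : ℕ) :
    #(turanGraph (m + 1) r).edgeFinset + m / r = #(turanGraph m r).edgeFinset + m := by
  -- A double sum over `range` lets `sum_range_succ` split off the new vertex m, whose
  -- non-neighbours are the m / r earlier vertices in its residue class.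
  have key : ∀ n, 2 * #(turanGraph n r).edgeFinset =
      ∑ v ∈ range n, ∑ w ∈ range n, if v % r ≠ w % r then 1 else 0 := by
    intro n
    rw [← sum_degrees_eq_twice_card_edges, ← Fin.sum_univ_eq_sum_range
      (fun v ↦ ∑ w ∈ range n, if v % r ≠ w % r then 1 else 0)]
    refine sum_congr rfl fun v _ ↦ ?_
    rw [← card_neighborFinset_eq_degree, neighborFinset_eq_filter, card_filter,
      ← Fin.sum_univ_eq_sum_range fun w ↦ if v % r ≠ w % r then 1 else 0]
    exact sum_congr rfl fun w _ ↦ if_congr turanGraph_adj rfl rfl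
  have h1 := key (m + 1)
  have h2 := key m
  simp only [sum_range_succ, sum_add_distrib] at h1
  have hsymm : ∑ x ∈ range m, (if x % r ≠ m % r then 1 else 0) =
      ∑ x ∈ range m, (if m % r ≠ x % r then 1 else 0) :=
    sum_congr rfl fun x _ ↦ by simp only [ne_comm]
  have hcount : (∑ x ∈ range m, (if x % r ≠ m % r then 1 else 0)) + m / r = m := by
    have hc : #{x ∈ range m | x % r = m % r} = m / r := by
      have h := Nat.count_modEq_card m hr m
      rw [Nat.count_eq_card_filter_range] at h
      have e : m / r + (if m % r < m % r then 1 else 0) = m / r := by simp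
      rw [← e, ← h]
      exact congrArg card (filter_congr fun x _ ↦ Iff.rfl)
    have h := card_filter_add_card_filter_not (s := range m) (fun x ↦ x % r = m % r)
    rw [hc, card_range] at h
    rw [← card_filter]
    simp only [ne_eq]
    omega
  simp only [ne_eq, not_true_eq_false, if_false, add_zero] at *
  omega

lemma card_edgeFinset_turanGraph_zero_left (r : ℕ) : #(turanGraph 0 r).edgeFinset = 0 := by
  rw [card_edgeFinset_turanGraph]; simp

/-- For `c ≤ r`, the increment of the Turán number from `b` to `b + d` vertices is at least
`(1 - 1 / c) * (b + (b + 1) + ⋯ + (b + d - 1))`. -/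
lemma le_card_edgeFinset_turanGraph_sub {c r : ℕ} (hc : 0 < c) (hcr : c ≤ r) (b d : ℕ) :
    ((c : ℤ) - 1) * ((b + d) * (b + d - 1) - b * (b - 1)) ≤
      2 * c * (#(turanGraph (b + d) r).edgeFinset - #(turanGraph b r).edgeFinset) := by
  induction d with
  | zero => simp
  | succ d ih =>
    have h := card_edgeFinset_turanGraph_succ (hc.trans_le hcr) (b + d)
    have h2 : c * ((b + d) / r) ≤ b + d :=
      (Nat.mul_le_mul_right _ hcr).trans (Nat.mul_div_le _ _)
    rw [← add_assoc]
    zify at h h2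
    push_cast at *
    nlinarith

lemma card_edgeFinset_turanGraph_three (m : ℕ) :
    3 * #(turanGraph m 3).edgeFinset ≤ m ^ 2 ∧ m ^ 2 ≤ 3 * #(turanGraph m 3).edgeFinset + 1 := by
  suffices h : (3 * #(turanGraph m 3).edgeFinset + (if m % 3 = 0 then 0 else 1) = m ^ 2) by
    split_ifs at h <;> omega
  induction m with
  | zero => simp [card_edgeFinset_turanGraph_zero_left]
  | succ m ih =>
    have h := card_edgeFinset_turanGraph_succ (r := 3) (by norm_num) m
    have h' : (m + 1) ^ 2 = m ^ 2 + 2 * m + 1 := by ring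
    rw [h']
    split_ifs at ih ⊢ <;> omega

/-- The rounding loss here does not grow with m. Summing the increments as in
`le_card_edgeFinset_turanGraph_sub` would lose too much for r = 4. -/
lemma card_edgeFinset_turanGraph_four (m : ℕ) :
    8 * #(turanGraph m 4).edgeFinset ≤ 3 * m ^ 2 ∧
      3 * m ^ 2 ≤ 8 * #(turanGraph m 4).edgeFinset + 4 := by
  suffices h : (8 * #(turanGraph m 4).edgeFinset +
      (if m % 4 = 0 then 0 else if m % 4 = 2 then 4 else 3) = 3 * m ^ 2) by
    split_ifs at h <;> omega
  induction m with
  | zero => simp [card_edgeFinset_turanGraph_zero_left]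
  | succ m ih =>
    have h := card_edgeFinset_turanGraph_succ (r := 4) (by norm_num) m
    have h' : 3 * (m + 1) ^ 2 = 3 * m ^ 2 + 6 * m + 3 := by ring
    rw [h']
    split_ifs at ih ⊢ <;> omega

/-- For `r ≥ 4`, having `s ≥ 2` vertices of degree at most `s + k` costs edges. -/
lemma card_edgeFinset_turanGraph_add_mul_le {n r k s : ℕ} (hr : 4 ≤ r)
    (hn : (if r ≤ 7 then 5 * k + 11 else 2 * k + 9) ≤ n) (hs : 2 ≤ s)
    (hs' : 2 * s + k + 1 ≤ n) :
    #(turanGraph (n - s) r).edgeFinset + s * (s + k) ≤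
      #(turanGraph (n - 1) r).edgeFinset + (k + 1) := by
  -- With s = d + 1 and b = n - s, the claim is that the Turán number grows by at least d(d + k + 2)
  -- from b to b + d vertices. In each range of r, `hx` is what remains after a factor d is taken
  -- out.
  obtain ⟨d, rfl⟩ : ∃ d, s = d + 1 := ⟨s - 1, by omega⟩
  obtain ⟨b, rfl⟩ : ∃ b, n = b + d + 1 := ⟨n - (d + 1), by omega⟩
  have e1 : b + d + 1 - (d + 1) = b := by omega
  have e2 : b + d + 1 - 1 = b + d := by omega
  rw [e1, e2]
  have hd : (1 : ℤ) ≤ d := by omega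
  by_cases h4 : r = 4
  · subst h4
    have h1 := (card_edgeFinset_turanGraph_four b).1
    have h2 := (card_edgeFinset_turanGraph_four (b + d)).2
    simp only [Nat.reduceLeDiff, if_true] at hn
    zify at h1 h2 hn hs' ⊢
    -- This is 11/2 times `hs'` plus 1/2 times `hn`, with no slack. The rounding loss of 4 is below
    -- 8, so integrality absorbs it.
    have hx : (0 : ℤ) ≤ 6 * b - 5 * d - 8 * k - 16 := by linarith
    nlinarith [mul_nonneg (show (0 : ℤ) ≤ d by omega) hx]
  by_cases h7 : r ≤ 7
  · have h := le_card_edgeFinset_turanGraph_sub (c := 5) (by norm_num) (by omega : 5 ≤ r) b d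
    simp only [h7, if_true] at hn
    zify at hn hs' ⊢
    push_cast at h
    have hx : (0 : ℤ) ≤ 8 * b - 6 * d - 10 * k - 24 := by linarith
    nlinarith [mul_nonneg (show (0 : ℤ) ≤ d by omega) hx]
  · have h := le_card_edgeFinset_turanGraph_sub (c := 8) (by norm_num) (by omega : 8 ≤ r) b d
    simp only [h7, if_false] at hn
    zify at hn hs' ⊢
    push_cast at h
    have hx : (0 : ℤ) ≤ 14 * b - 9 * d - 16 * k - 39 := by linarith
    nlinarith [mul_nonneg (show (0 : ℤ) ≤ d by omega) hx]

lemma card_edgeFinset_turanGraph_add_mul_lt {n r k s : ℕ} (hr : 4 ≤ r)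
    (hn : (if r ≤ 7 then 6 * k + 2 * r + 3 else 2 * k + 2 * r) ≤ n) (hs : 2 ≤ s)
    (hs' : 2 * s + k + 1 ≤ n) (hex : ¬ (r = 4 ∧ k = 0 ∧ n = 11 ∧ s = 5)) :
    #(turanGraph (n - s) r).edgeFinset + s * (s + k) <
      #(turanGraph (n - 1) r).edgeFinset + (k + 1) := by
  obtain ⟨d, rfl⟩ : ∃ d, s = d + 1 := ⟨s - 1, by omega⟩
  obtain ⟨b, rfl⟩ : ∃ b, n = b + d + 1 := ⟨n - (d + 1), by omega⟩
  have e1 : b + d + 1 - (d + 1) = b := by omega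
  have e2 : b + d + 1 - 1 = b + d := by omega
  rw [e1, e2]
  have hd : (1 : ℤ) ≤ d := by omega
  by_cases h4 : r = 4
  · subst h4
    have h1 := (card_edgeFinset_turanGraph_four b).1
    have h2 := (card_edgeFinset_turanGraph_four (b + d)).2
    simp only [Nat.reduceLeDiff, if_true] at hn
    -- Strictness must beat the rounding loss 4, so d times the right-hand factor has to be at least
    -- 5. The excluded tuple is b = 6, d = 4, where the factor vanishes.
    have hx : (d ≤ 4 ∧ (5 : ℤ) ≤ 6 * b - 5 * d - 8 * k - 16) ∨
        5 ≤ d ∧ (1 : ℤ) ≤ 6 * b - 5 * d - 8 * k - 16 := by omega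
    zify at h1 h2 hn hs' ⊢
    rcases hx with ⟨-, hx⟩ | ⟨h5, hx⟩
    · nlinarith [mul_le_mul hd hx (by norm_num) (by omega)]
    · have h5' : (5 : ℤ) ≤ d := by exact_mod_cast h5
      nlinarith [mul_le_mul h5' hx (by norm_num) (by omega)]
  by_cases h7 : r ≤ 7
  · have h := le_card_edgeFinset_turanGraph_sub (c := 5) (by norm_num) (by omega : 5 ≤ r) b d
    simp only [h7, if_true] at hn
    have hx : (1 : ℤ) ≤ 8 * b - 6 * d - 10 * k - 24 := by omega
    zify at hn hs' ⊢
    push_cast at h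
    nlinarith [mul_le_mul hd hx (by norm_num) (by omega)]
  · have h := le_card_edgeFinset_turanGraph_sub (c := 8) (by norm_num) (by omega : 8 ≤ r) b d
    simp only [h7, if_false] at hn
    have hx : (1 : ℤ) ≤ 14 * b - 9 * d - 16 * k - 39 := by omega
    zify at hn hs' ⊢
    push_cast at h
    nlinarith [mul_le_mul hd hx (by norm_num) (by omega)]

/-- For r = 3, deletion wins only while s stays below about 2n/5; the remaining s are left to
`CliqueFree.card_edgeFinset_lt_of_degree_le`. -/
lemma card_edgeFinset_turanGraph_three_add_mul_lt {n k s : ℕ}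
    (hn : 6 * k + 26 ≤ n) (hs : 2 ≤ s) (hs' : 5 * s + 3 * k < 2 * n) :
    #(turanGraph (n - s) 3).edgeFinset + s * (s + k) <
      #(turanGraph (n - 1) 3).edgeFinset + (k + 1) := by
  obtain ⟨d, rfl⟩ : ∃ d, s = d + 1 := ⟨s - 1, by omega⟩
  obtain ⟨b, rfl⟩ : ∃ b, n = b + d + 1 := ⟨n - (d + 1), by omega⟩
  have e1 : b + d + 1 - (d + 1) = b := by omega
  have e2 : b + d + 1 - 1 = b + d := by omega
  rw [e1, e2]
  have hd : (1 : ℤ) ≤ d := by omega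
  have h := le_card_edgeFinset_turanGraph_sub (c := 3) (by norm_num) le_rfl b d
  have hx : (1 : ℤ) ≤ 2 * b - 2 * d - 3 * k - 7 := by omega
  zify at hn hs' ⊢
  push_cast at h
  nlinarith [mul_le_mul hd hx (by norm_num) (by omega)]

/-- The left side is the bound from the weighted argument, with i = s + k. It increases for i <
2n/3, so the worst case is i = (n - 1 + k)/2; for k = 0 the leading terms are 5n²/16 against n²/3.
-/
lemma mul_sub_lt_card_edgeFinset_turanGraph_three {n k i : ℕ} (hn : 6 * k + 26 ≤ n)
    (hi : 2 * i + 1 ≤ n + k) :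
    (n * i - 3 / 4 * i ^ 2 : ℝ) < (#(turanGraph (n - 1) 3).edgeFinset + (k + 1) : ℕ) := by
  have h := (card_edgeFinset_turanGraph_three (n - 1)).2
  obtain ⟨m, rfl⟩ : ∃ m, n = m + 1 := ⟨n - 1, by omega⟩
  have h' : ((m : ℝ)) ^ 2 ≤ 3 * (#(turanGraph m 3).edgeFinset : ℝ) + 1 := by exact_mod_cast h
  have hn' : 6 * (k : ℝ) + 26 ≤ m + 1 := by exact_mod_cast hn
  have hi' : 2 * (i : ℝ) ≤ m + k := by
    have : 2 * i ≤ m + k := by omega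
    exact_mod_cast this
  have hk : (0 : ℝ) ≤ k := k.cast_nonneg
  have e : m + 1 - 1 = m := rfl
  rw [e]
  push_cast
  have mono : ((m : ℝ) + 1) * i - 3 / 4 * i ^ 2 ≤
      (m + 1) * ((m + k) / 2) - 3 / 4 * ((m + k) / 2) ^ 2 := by
    have h1 : (0 : ℝ) ≤ (m + k) / 2 - i := by linarith
    have h2 : (0 : ℝ) ≤ (m + 1) - 3 / 4 * ((m + k) / 2 + i) := by linarith
    nlinarith [mul_nonneg h1 h2]
  nlinarith [mul_nonneg hk hk, mul_nonneg (show (0:ℝ) ≤ m by linarith)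
    (show (0:ℝ) ≤ m + 1 - 6 * k - 26 by linarith)]

/-! ### Positions and splittings along paths -/

lemma Walk.IsPath.getVert_inj {V : Type*} {H : SimpleGraph V} {x y : V} {q : H.Walk x y} (hq : q.IsPath)
    {i j : ℕ} (hi : i ≤ q.length) (hj : j ≤ q.length) (h : q.getVert i = q.getVert j) : i = j :=
  hq.getVert_injOn hi hj h

lemma Walk.exists_append_cons {V : Type*} {H : SimpleGraph V} {u v : V} (p : H.Walk u v) {j : ℕ}
    (hj : j < p.length) :
    ∃ (p₁ : H.Walk u (p.getVert j)) (h : H.Adj (p.getVert j) (p.getVert (j + 1)))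
      (p₂ : H.Walk (p.getVert (j + 1)) v), p = p₁.append (cons h p₂) := by
  induction p generalizing j with
  | nil => simp at hj
  | @cons u w v h p ih =>
    cases j with
    | zero =>
      refine ⟨nil, by simpa using h, p.copy (by simp) rfl, ?_⟩
      cases p <;> rfl
    | succ j =>
      obtain ⟨p₁, h', p₂, e⟩ := ih (j := j) (by simpa using hj)
      exact ⟨cons h p₁, h', p₂, by simpa [Walk.append] using congrArg (cons h) e⟩

/-! ### Hamiltonian cycles through prescribed edges, and the closure -/

section HamiltonianThrough

variable {V : Type*} [Fintype V] [DecidableEq V]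

/-- `H` has a Hamiltonian cycle that uses all the edges in `F`. -/
def HasHamiltonianCycleThrough (H : SimpleGraph V) (F : Finset (Sym2 V)) : Prop :=
  ∃ (a : V) (c : H.Walk a a), c.IsHamiltonianCycle ∧ ∀ e ∈ F, e ∈ c.edges

lemma Walk.IsHamiltonian.cons_isHamiltonianCycle {H : SimpleGraph V} {x y : V} {q : H.Walk x y}
    (hq : q.IsHamiltonian) (h : H.Adj y x) (hV : 3 ≤ Fintype.card V) :
    (Walk.cons h q).IsHamiltonianCycle := by
  rw [isHamiltonianCycle_iff_isCycle_and_length_eq, cons_isCycle_iff, length_cons]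
  have hl := hq.length_eq
  refine ⟨⟨hq.isPath, fun he ↦ ?_⟩, by omega⟩
  have := hq.isPath.length_eq_one_of_mem_edges (Sym2.eq_swap ▸ he)
  omega

lemma HasHamiltonianCycleThrough.exists_isHamiltonian {H : SimpleGraph V} {F : Finset (Sym2 V)}
    {u v : V} (hF : ↑F ⊆ H.edgeSet) (hH : ¬ H.HasHamiltonianCycleThrough F)
    (huv : ¬ H.Adj u v) (h : (H ⊔ edge u v).HasHamiltonianCycleThrough F) :
    ∃ p : H.Walk u v, p.IsHamiltonian ∧ ∀ e ∈ F, e ∈ p.edges := by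
  obtain ⟨a, c, hc, hcF⟩ := h
  have hedge : ∀ e ∈ (H ⊔ edge u v).edgeSet, e ≠ s(u, v) → e ∈ H.edgeSet := by
    intro e
    induction e with
    | _ x y =>
      simp only [mem_edgeSet, sup_adj, edge_adj]
      rintro (h | ⟨⟨rfl, rfl⟩ | ⟨rfl, rfl⟩, -⟩) hne
      · exact h
      · exact absurd rfl hne
      · exact absurd Sym2.eq_swap hne
  have hne : ∀ e ∈ F, e ≠ s(u, v) := by
    rintro e he rfl
    exact huv (hF he)
  -- It is enough to treat a cycle whose first edge is uv, in either orientation; deleting that edge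
  -- leaves the path.
  suffices key : ∀ x y, s(x, y) = s(u, v) → ∀ (c : (H ⊔ edge u v).Walk x x),
      c.IsHamiltonianCycle → (∀ e ∈ F, e ∈ c.edges) → (hadj : (H ⊔ edge u v).Adj x y) →
      (q : (H ⊔ edge u v).Walk y x) → c = Walk.cons hadj q →
      ∃ p : H.Walk u v, p.IsHamiltonian ∧ ∀ e ∈ F, e ∈ p.edges by
    by_cases hmem : s(u, v) ∈ c.edges
    · rw [Walk.edges, List.mem_map] at hmem
      obtain ⟨d, hd, hde⟩ := hmem
      have hd1 : d.fst ∈ c.support := c.dart_fst_mem_support_of_mem_darts hd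
      have hd2 : d ∈ (c.rotate d.fst hd1).darts := (c.rotate_darts _ hd1).mem_iff.2 hd
      have hc' := hc.rotate hd1
      have hcF' : ∀ e ∈ F, e ∈ (c.rotate d.fst hd1).edges := fun e he ↦
        (c.rotate_edges _ hd1).mem_iff.2 (hcF e he)
      generalize c.rotate d.fst hd1 = c' at hd2 hc' hcF'
      cases c' with
      | nil => simp at hd2
      | @cons _ w _ hadj q =>
        have hq := (Walk.cons_isCycle_iff _ _).1 hc'.isCycle
        rw [Walk.darts_cons, List.mem_cons] at hd2
        rcases hd2 with hd2 | hd2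
        · refine key d.fst w ?_ _ hc' hcF' hadj q rfl
          rw [← hde]
          conv_rhs => rw [hd2]
          rfl
        -- The rotated cycle starts at `d.fst`, which is the last vertex of the path `q`; no dart of
        -- a path leaves its last vertex.
        · exfalso
          obtain ⟨i, hi, hii⟩ := List.mem_iff_getElem.1 hd2
          have hfst : q.darts[i].fst = d.fst := by rw [hii]
          rw [Walk.fst_darts_getElem, List.getElem_dropLast, Walk.support_getElem_eq_getVert]
            at hfst
          rw [Walk.length_darts] at hi
          have : i = q.length := hq.1.getVert_injOn (by simpa using hi.le) (by simp)
            (by rw [hfst]; simp)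
          omega
    · refine absurd ⟨a, c.transfer H fun e he ↦ hedge e (c.edges_subset_edgeSet he) ?_, ?_, ?_⟩ hH
      · rintro rfl
        exact hmem he
      · rw [Walk.isHamiltonianCycle_iff_isCycle_and_length_eq, Walk.length_transfer]
        exact ⟨hc.isCycle.transfer _, hc.length_eq⟩
      · simpa using hcF
  intro x y hxy c hc hcF hadj q hcq
  subst hcq
  have hq := (Walk.cons_isCycle_iff _ _).1 hc.isCycle
  have hlen := hc.length_eq
  have hF' : ∀ e ∈ F, e ∈ q.edges := by
    intro e he
    have := hcF e he
    rw [Walk.edges_cons, List.mem_cons] at this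
    rcases this with h | h
    · exact absurd (h.trans hxy) (hne e he)
    · exact h
  have hqe : ∀ e ∈ q.edges, e ∈ H.edgeSet := by
    intro e he
    refine hedge e (q.edges_subset_edgeSet he) ?_
    rintro rfl
    exact hq.2 (hxy ▸ he)
  have hham : (q.transfer H hqe).IsHamiltonian := by
    rw [Walk.isHamiltonian_iff_isPath_and_length_eq, Walk.length_transfer]
    rw [Walk.length_cons] at hlen
    exact ⟨hq.1.transfer _, by omega⟩
  rcases Sym2.eq_iff.1 hxy with ⟨rfl, rfl⟩ | ⟨rfl, rfl⟩
  · refine ⟨(q.transfer H hqe).reverse, ?_, by simpa using hF'⟩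
    intro a
    rw [Walk.support_reverse, List.count_reverse]
    exact hham a
  · exact ⟨q.transfer H hqe, hham, by simpa using hF'⟩

lemma Walk.IsHamiltonian.card_adj_getVert_succ {H : SimpleGraph V} [DecidableRel H.Adj] {u v : V}
    {p : H.Walk u v} (hp : p.IsHamiltonian) :
    #{j ∈ range p.length | H.Adj u (p.getVert (j + 1))} = H.degree u := by
  rw [← card_neighborFinset_eq_degree]
  refine card_bij (fun j _ ↦ p.getVert (j + 1)) ?_ ?_ ?_
  · simp
  · intro i hi j hj e
    simp only [mem_filter, mem_range] at hi hj
    have := hp.isPath.getVert_inj hi.1 hj.1 e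
    omega
  · intro w hw
    obtain ⟨i, rfl, hi⟩ := Walk.mem_support_iff_exists_getVert.1 (hp.mem_support w)
    rw [mem_neighborFinset] at hw
    cases i with
    | zero => simp at hw
    | succ i => exact ⟨i, by simpa using ⟨hi, hw⟩, rfl⟩

lemma Walk.IsHamiltonian.card_adj_getVert {H : SimpleGraph V} [DecidableRel H.Adj] {u v : V}
    {p : H.Walk u v} (hp : p.IsHamiltonian) :
    #{j ∈ range p.length | H.Adj v (p.getVert j)} = H.degree v := by
  rw [← card_neighborFinset_eq_degree]
  refine card_bij (fun j _ ↦ p.getVert j) ?_ ?_ ?_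
  · simp
  · intro i hi j hj e
    simp only [mem_filter, mem_range] at hi hj
    exact hp.isPath.getVert_inj hi.1.le hj.1.le e
  · intro w hw
    obtain ⟨i, rfl, hi⟩ := Walk.mem_support_iff_exists_getVert.1 (hp.mem_support w)
    rw [mem_neighborFinset] at hw
    refine ⟨i, ?_, rfl⟩
    rcases hi.lt_or_eq with hi | rfl
    · simpa using ⟨hi, hw⟩
    · simp at hw

/-- If a Hamiltonian path through `F` cannot be closed up to a Hamiltonian cycle through `F` by
a single exchange, then the degrees of its ends are small. -/
lemma Walk.IsHamiltonian.degree_add_degree_le {H : SimpleGraph V} [DecidableRel H.Adj] {u v : V}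
    {p : H.Walk u v} (hp : p.IsHamiltonian) {F : Finset (Sym2 V)} (hF : ∀ e ∈ F, e ∈ p.edges)
    (hH : ¬ H.HasHamiltonianCycleThrough F) (hV : 3 ≤ Fintype.card V) :
    H.degree u + H.degree v + 1 ≤ Fintype.card V + #F := by
  set I := {j ∈ range p.length | H.Adj u (p.getVert (j + 1))}
  set J := {j ∈ range p.length | H.Adj v (p.getVert j)}
  have hI : #I = H.degree u := hp.card_adj_getVert_succ
  have hJ : #J = H.degree v := hp.card_adj_getVert
  have hlen := hp.length_eq
  have hunion : #(I ∪ J) ≤ p.length := by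
    rw [← card_range p.length]
    exact card_le_card (union_subset (filter_subset _ _) (filter_subset _ _))
  -- At an index j in both sets, going from u to p_j, across to v, back to p_{j+1} and across to u
  -- is a Hamiltonian cycle that misses only the edge p_j p_{j+1} of the path. That edge must
  -- therefore lie in `F`.
  have hinter : #(I ∩ J) ≤ #F := by
    refine card_le_card_of_injOn (fun j ↦ s(p.getVert j, p.getVert (j + 1))) ?_ ?_
    · intro j hj
      simp only [I, J, coe_inter, coe_filter, mem_range, Set.mem_inter_iff,
        Set.mem_ofPred_eq] at hj
      obtain ⟨⟨hlt, hu⟩, -, hv⟩ := hj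
      by_contra hjF
      obtain ⟨p₁, h, p₂, e⟩ := p.exists_append_cons hlt
      refine hH ⟨_, Walk.cons hu.symm (p₁.append (Walk.cons hv.symm p₂.reverse)), ?_, ?_⟩
      · refine Walk.IsHamiltonian.cons_isHamiltonianCycle (fun a ↦ ?_) _ hV
        have := hp a
        rw [e] at this
        simpa [Walk.support_append] using this
      · intro f hf
        have hne : f ≠ s(p.getVert j, p.getVert (j + 1)) := by
          rintro rfl
          exact hjF hf
        have := hF f hf
        rw [e, Walk.edges_append, Walk.edges_cons, List.mem_append, List.mem_cons] at this
        simp only [Walk.edges_cons, Walk.edges_append, Walk.edges_reverse, List.mem_cons,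
          List.mem_append, List.mem_reverse]
        tauto
    · intro i hi j hj e
      simp only [I, J, coe_inter, coe_filter, mem_range, Set.mem_inter_iff,
        Set.mem_ofPred_eq] at hi hj
      rcases Sym2.eq_iff.1 e with ⟨e1, -⟩ | ⟨e1, e2⟩
      · exact hp.isPath.getVert_inj hi.1.1.le hj.1.1.le e1
      · have h1 := hp.isPath.getVert_inj hi.1.1.le hj.1.1 e1
        have h2 := hp.isPath.getVert_inj hi.1.1 hj.1.1.le e2
        omega
  have := card_union_add_card_inter I J
  omega

/-- A path whose ends and whose outside form a clique extends to a Hamiltonian cycle. -/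
lemma Walk.IsPath.hasHamiltonianCycleThrough {H : SimpleGraph V} {S : Set V}
    (hS : S.Pairwise H.Adj) {a b : V} (p : H.Walk a b) (hp : p.IsPath) (ha : a ∈ S) (hb : b ∈ S)
    (hout : ∀ w, w ∉ p.support → w ∈ S) (hV : 3 ≤ Fintype.card V) {F : Finset (Sym2 V)}
    (hF : ∀ e ∈ F, e ∈ p.edges) :
    H.HasHamiltonianCycleThrough F := by
  induction hm : Fintype.card V - p.length using Nat.strong_induction_on generalizing b with
  | _ m ih =>
    by_cases hall : ∀ w, w ∈ p.support
    · have hham : p.IsHamiltonian := hp.isHamiltonian_of_mem hall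
      have hab : a ≠ b := by
        rintro rfl
        have := hham.length_eq
        rw [Walk.length_eq_zero_iff.2 (Walk.isPath_iff_nil.1 hp)] at this
        omega
      exact ⟨_, _, hham.cons_isHamiltonianCycle (hS hb ha hab.symm) hV,
        fun e he ↦ by simp [hF e he]⟩
    · push Not at hall
      obtain ⟨w, hw⟩ := hall
      have hbw : H.Adj b w := hS hb (hout w hw) (by rintro rfl; simp at hw)
      have hp' : (p.concat hbw).IsPath := hp.concat hw hbw
      have hlt := hp'.length_lt
      rw [Walk.length_concat] at hlt
      refine ih (Fintype.card V - (p.length + 1)) (by omega) (p.concat hbw) hp'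
        (hout w hw) ?_ ?_ (by rw [Walk.length_concat])
      · intro x hx
        refine hout x fun h ↦ hx ?_
        simp [Walk.support_concat, h]
      · intro e he
        simp [Walk.edges_concat, hF e he]

/-- Closure: a graph without a Hamiltonian cycle through `F` is contained in one in which
nonadjacent vertices have small degree sum. -/
lemma exists_le_degree_add_degree_le {G : SimpleGraph V} {F : Finset (Sym2 V)}
    (hF : ↑F ⊆ G.edgeSet) (hG : ¬ G.HasHamiltonianCycleThrough F) (hV : 3 ≤ Fintype.card V) :
    ∃ H : SimpleGraph V, G ≤ H ∧ ¬ H.HasHamiltonianCycleThrough F ∧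
      ∀ [DecidableRel H.Adj] (u v : V), u ≠ v → ¬ H.Adj u v →
        H.degree u + H.degree v + 1 ≤ Fintype.card V + #F := by
  obtain ⟨H, hGH, hmax⟩ := Finite.exists_le_maximal
    (p := fun H : SimpleGraph V ↦ ¬ H.HasHamiltonianCycleThrough F) hG
  refine ⟨H, hGH, hmax.prop, fun {_} u v hne huv ↦ ?_⟩
  have hlt : (H ⊔ edge u v).HasHamiltonianCycleThrough F := by
    by_contra hcon
    have hle := hmax.le_of_ge hcon le_sup_left
    exact huv (hle (Or.inr (by simp [edge_adj, hne])))
  obtain ⟨p, hp, hpF⟩ := hlt.exists_isHamiltonian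
    (hF.trans (edgeSet_mono hGH)) hmax.prop huv
  exact hp.degree_add_degree_le hpF hmax.prop hV

end HamiltonianThrough

/-! ### Edge bounds for clique-free graphs -/

lemma CliqueFree.card_edgeFinset_le_turanGraph {V : Type*} [Fintype V] {G : SimpleGraph V} [DecidableRel G.Adj] {r : ℕ}
    (hG : G.CliqueFree (r + 1)) :
    #G.edgeFinset ≤ #(turanGraph (Fintype.card V) r).edgeFinset := by
  rw [card_edgeFinset_turanGraph]
  exact hG.card_edgeFinset_le

section EdgeBounds

variable {V : Type*} [Fintype V] [DecidableEq V]

open Matrix in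
/-- The Motzkin–Straus theorem. -/
theorem CliqueFree.mul_dotProduct_adjMatrix_le {G : SimpleGraph V} [DecidableRel G.Adj] {r : ℕ}
    (hG : G.CliqueFree (r + 1)) (w : V → ℝ) (hw : ∀ v, 0 ≤ w v) :
    r * (w ⬝ᵥ (G.adjMatrix ℝ *ᵥ w)) ≤ (r - 1) * (∑ v, w v) ^ 2 := by
  induction hm : #{v | w v ≠ 0} using Nat.strong_induction_on generalizing w with
  | _ m ih =>
    -- If the support is a clique it has at most r vertices, and Cauchy–Schwarz bounds the missing
    -- diagonal terms.
    by_cases hcl : G.IsClique ({v | w v ≠ 0} : Finset V)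
    · have hcard : #{v | w v ≠ 0} ≤ r := by
        by_contra! hlt
        exact (hG.mono hlt) _ ⟨hcl, rfl⟩
      have h1 : (∑ v, w v) ^ 2 ≤ r * ∑ v, w v ^ 2 := by
        have := sq_sum_le_card_mul_sum_sq (s := {v | w v ≠ 0}) (f := w)
        rw [sum_filter_ne_zero, sum_filter_of_ne (by intro x _ h; simpa using h)] at this
        refine this.trans ?_
        gcongr
      have h2 : w ⬝ᵥ (G.adjMatrix ℝ *ᵥ w) + ∑ v, w v ^ 2 ≤ (∑ v, w v) ^ 2 := by
        have h : (∑ v, w v) ^ 2 = ∑ u, w u * ∑ v, w v := by rw [sq, sum_mul]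
        rw [h, dotProduct, ← sum_add_distrib]
        refine sum_le_sum fun u _ ↦ ?_
        rw [sq, ← mul_add]
        refine mul_le_mul_of_nonneg_left ?_ (hw u)
        rw [mulVec, dotProduct, ← add_sum_erase univ w (mem_univ u),
          ← add_sum_erase univ _ (mem_univ u), adjMatrix_apply, if_neg (G.irrefl), zero_mul,
          zero_add, add_comm]
        refine add_le_add_right (sum_le_sum fun v _ ↦ ?_) _
        rw [adjMatrix_apply]
        split_ifs <;> simp [hw v]
      have hr : (0 : ℝ) ≤ r := r.cast_nonneg
      nlinarith
    · have hcl' : ∃ u v, w u ≠ 0 ∧ w v ≠ 0 ∧ u ≠ v ∧ ¬ G.Adj u v ∧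
          (G.adjMatrix ℝ *ᵥ w) v ≤ (G.adjMatrix ℝ *ᵥ w) u := by
        simp only [isClique_iff, Set.Pairwise, coe_filter, mem_univ, true_and,
          Set.mem_ofPred_eq] at hcl
        push Not at hcl
        obtain ⟨u, hu, v, hv, hne, hadj⟩ := hcl
        rcases le_total ((G.adjMatrix ℝ *ᵥ w) v) ((G.adjMatrix ℝ *ᵥ w) u) with h | h
        · exact ⟨u, v, hu, hv, hne, hadj, h⟩
        · exact ⟨v, u, hv, hu, hne.symm, fun h ↦ hadj h.symm, h⟩
      obtain ⟨u, v, hu, hv, hne, hadj, hle⟩ := hcl'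
      -- Move all the weight of v to u. As u and v are nonadjacent, the form has no quadratic term
      -- along `h`, so it does not decrease; the total weight is kept and the support loses v.
      set h : V → ℝ := Pi.single u (w v) - Pi.single v (w v) with hh
      have hhu : h u = w v := by simp [hh, hne]
      have hhv : h v = - w v := by simp [hh, hne.symm]
      have hho : ∀ x, x ≠ u → x ≠ v → h x = 0 := by
        intro x hxu hxv
        simp [hh, hxu, hxv]
      have hnn : ∀ x, 0 ≤ (w + h) x := by
        intro x
        by_cases hxu : x = u
        · subst hxu
          simpa [hhu] using add_nonneg (hw x) (hw v)
        by_cases hxv : x = v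
        · subst hxv
          simp [hhv]
        simpa [hho x hxu hxv] using hw x
      have hsum : ∑ x, (w + h) x = ∑ x, w x := by
        simp [hh, sum_add_distrib]
      have hlt : #{x | (w + h) x ≠ 0} < #{x | w x ≠ 0} := by
        refine card_lt_card ⟨fun x hx ↦ ?_, fun hsub ↦ ?_⟩
        · simp only [mem_filter, mem_univ, true_and] at hx ⊢
          by_cases hxu : x = u
          · rwa [hxu]
          by_cases hxv : x = v
          · rwa [hxv]
          simpa [hho x hxu hxv] using hx
        · have := hsub (show v ∈ ({x | w x ≠ 0} : Finset V) by simpa using hv)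
          simp [hhv] at this
      have key := ih _ (hm ▸ hlt) (w + h) hnn rfl
      rw [hsum] at key
      refine le_trans (mul_le_mul_of_nonneg_left ?_ r.cast_nonneg) key
      have hdot : ∀ x : V → ℝ, h ⬝ᵥ x = w v * (x u - x v) := by
        intro x
        rw [hh, sub_dotProduct, single_dotProduct, single_dotProduct]
        ring
      have hsymm : w ⬝ᵥ (G.adjMatrix ℝ *ᵥ h) = h ⬝ᵥ (G.adjMatrix ℝ *ᵥ w) := by
        rw [dotProduct_mulVec, ← mulVec_transpose, transpose_adjMatrix, dotProduct_comm]
      have hhh : h ⬝ᵥ (G.adjMatrix ℝ *ᵥ h) = 0 := by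
        rw [hdot]
        have e1 : (G.adjMatrix ℝ *ᵥ h) u = 0 := by
          rw [mulVec, dotProduct_comm, hdot]
          simp [hadj]
        have e2 : (G.adjMatrix ℝ *ᵥ h) v = 0 := by
          rw [mulVec, dotProduct_comm, hdot]
          simp [hadj, G.adj_comm v u]
        rw [e1, e2]
        simp
      rw [mulVec_add, add_dotProduct, dotProduct_add, dotProduct_add, hsymm, hhh, hdot]
      have := mul_nonneg (hw v) (sub_nonneg.2 hle)
      linarith

/-- A weighted Turán bound for a clique-free graph with a set `A` of vertices of small degree. -/
lemma CliqueFree.mul_card_edgeFinset_sub_le {G : SimpleGraph V} [DecidableRel G.Adj] {r : ℕ}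
    (hG : G.CliqueFree (r + 1)) (A : Finset V) {c : ℝ} (hc0 : 0 ≤ c) (hc1 : c ≤ 1) :
    r * (2 * #G.edgeFinset - 2 * c * ∑ v ∈ A, (G.degree v : ℝ)) ≤
      (r - 1) * (Fintype.card V - c * #A) ^ 2 := by
  set f : V → ℝ := fun v ↦ if v ∈ A then 1 else 0 with hf
  have hf01 : ∀ v, 0 ≤ f v ∧ f v ≤ 1 := by
    intro v
    simp only [hf]
    split_ifs <;> norm_num
  -- Vertices of `A` get weight 1 - c, all others weight 1.
  have key := hG.mul_dotProduct_adjMatrix_le (fun v ↦ 1 - c * f v) (by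
    intro v
    have := hf01 v
    nlinarith)
  have hsum : ∑ v, (1 - c * f v) = Fintype.card V - c * #A := by
    simp [hf, sum_sub_distrib, mul_comm]
  rw [hsum] at key
  refine le_trans (mul_le_mul_of_nonneg_left ?_ r.cast_nonneg) key
  have hdeg : ∀ u, (G.degree u : ℝ) = ∑ v, G.adjMatrix ℝ u v := by
    intro u
    simp [adjMatrix_apply, ← card_neighborFinset_eq_degree, neighborFinset_eq_filter]
  have h1 : ∑ u, (G.degree u : ℝ) = 2 * #G.edgeFinset := by
    exact_mod_cast G.sum_degrees_eq_twice_card_edges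
  have h2 : ∑ v ∈ A, (G.degree v : ℝ) = ∑ u, f u * G.degree u := by
    simp [hf, sum_ite_mem]
  have h3 : ∑ u, f u * (G.degree u : ℝ) = ∑ u, ∑ v, G.adjMatrix ℝ u v * f v := by
    rw [sum_comm]
    refine sum_congr rfl fun u _ ↦ ?_
    rw [hdeg, mul_sum]
    refine sum_congr rfl fun v _ ↦ ?_
    simp [adjMatrix_apply, G.adj_comm u v]
  have h4 : 2 * (#G.edgeFinset : ℝ) - 2 * c * ∑ v ∈ A, (G.degree v : ℝ) =
      ∑ u, ∑ v, G.adjMatrix ℝ u v * (1 - c * f u - c * f v) := by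
    have h5 : ∀ u, ∑ v, G.adjMatrix ℝ u v * (1 - c * f u - c * f v) =
        G.degree u - c * (f u * G.degree u) - c * ∑ v, G.adjMatrix ℝ u v * f v := by
      intro u
      rw [hdeg, mul_sum, mul_sum, mul_sum, ← sum_sub_distrib, ← sum_sub_distrib]
      exact sum_congr rfl fun v _ ↦ by ring
    rw [sum_congr rfl fun u _ ↦ h5 u, sum_sub_distrib, sum_sub_distrib, ← mul_sum, ← mul_sum,
      h1, h2, ← h3]
    ring
  rw [h4, dotProduct]
  refine sum_le_sum fun u _ ↦ ?_
  rw [Matrix.mulVec, dotProduct, mul_sum]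
  refine sum_le_sum fun v _ ↦ ?_
  have hA : 0 ≤ G.adjMatrix ℝ u v := by
    rw [adjMatrix_apply]
    split_ifs <;> norm_num
  -- Dropping the term c² f(u) f(v) from (1 - c f(u))(1 - c f(v)) makes the estimate linear in the
  -- degrees.
  have := mul_nonneg hA (mul_nonneg (mul_nonneg hc0 (hf01 u).1) (mul_nonneg hc0 (hf01 v).1))
  nlinarith

/-- Splitting the edges of a graph along a set of vertices `A`. -/
lemma two_mul_card_edgeFinset_eq (G : SimpleGraph V) [DecidableRel G.Adj] (A : Finset V) :
    2 * #G.edgeFinset = 2 * #(G.induce ((Aᶜ : Finset V) : Set V)).edgeFinset +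
      ∑ v ∈ A, (G.degree v + #{w ∈ Aᶜ | G.Adj v w}) := by
  have hdeg : ∀ v, G.degree v = ∑ w, if G.Adj v w then 1 else 0 := by
    intro v
    rw [← card_neighborFinset_eq_degree, neighborFinset_eq_filter, card_filter]
  have hB : 2 * #(G.induce ((Aᶜ : Finset V) : Set V)).edgeFinset =
      ∑ v ∈ Aᶜ, ∑ w ∈ Aᶜ, if G.Adj v w then 1 else 0 := by
    rw [← sum_degrees_eq_twice_card_edges, ← sum_coe_sort Aᶜ]
    refine sum_congr rfl fun v _ ↦ ?_
    rw [← card_neighborFinset_eq_degree, neighborFinset_eq_filter, card_filter,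
      ← sum_coe_sort Aᶜ]
    exact sum_congr rfl fun w _ ↦ if_congr Iff.rfl rfl rfl
  have h1 : ∀ v, G.degree v = (∑ w ∈ A, if G.Adj v w then 1 else 0) +
      ∑ w ∈ Aᶜ, if G.Adj v w then 1 else 0 := fun v ↦ by rw [hdeg, sum_add_sum_compl]
  have h2 : ∑ v ∈ Aᶜ, ∑ w ∈ A, (if G.Adj v w then 1 else 0) =
      ∑ v ∈ A, ∑ w ∈ Aᶜ, (if G.Adj v w then 1 else 0) := by
    rw [sum_comm]
    simp only [G.adj_comm]
  rw [hB, ← sum_degrees_eq_twice_card_edges, ← sum_add_sum_compl A, sum_add_distrib,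
    sum_congr rfl fun v (_ : v ∈ Aᶜ) ↦ h1 v, sum_add_distrib, h2]
  simp only [card_filter]
  ring

lemma CliqueFree.card_edgeFinset_induce_compl_le {G : SimpleGraph V} [DecidableRel G.Adj] {r : ℕ}
    (hG : G.CliqueFree (r + 1)) (A : Finset V) :
    #(G.induce ((Aᶜ : Finset V) : Set V)).edgeFinset ≤
      #(turanGraph (Fintype.card V - #A) r).edgeFinset := by
  have := (hG.comap (Embedding.induce (G := G) ((Aᶜ : Finset V) : Set V)).isContained
    ).card_edgeFinset_le_turanGraph
  rwa [show Fintype.card ((Aᶜ : Finset V) : Set V) = Fintype.card V - #A by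
    rw [← card_compl]; exact Fintype.card_coe _] at this

lemma CliqueFree.card_edgeFinset_le_add_sum_degree {G : SimpleGraph V} [DecidableRel G.Adj]
    {r : ℕ} (hG : G.CliqueFree (r + 1)) (A : Finset V) :
    #G.edgeFinset ≤ #(turanGraph (Fintype.card V - #A) r).edgeFinset + ∑ v ∈ A, G.degree v := by
  have h1 := G.two_mul_card_edgeFinset_eq A
  have h2 := hG.card_edgeFinset_induce_compl_le A
  have h3 : ∑ v ∈ A, #{w ∈ Aᶜ | G.Adj v w} ≤ ∑ v ∈ A, G.degree v := by
    refine sum_le_sum fun v _ ↦ ?_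
    rw [← card_neighborFinset_eq_degree, neighborFinset_eq_filter]
    exact card_le_card (filter_subset_filter _ (subset_univ _))
  rw [sum_add_distrib] at h1
  omega

end EdgeBounds

/-! ### The Chvátal condition and the edge bound -/

section Chvatal

variable {V : Type*} [Fintype V] [DecidableEq V]

lemma exists_closure_of_not_isPathHamiltonian {G : SimpleGraph V} {k : ℕ}
    (hG : ¬ G.IsPathHamiltonian k) (hV : 3 ≤ Fintype.card V) :
    ∃ (a b : V) (p : G.Walk a b) (H : SimpleGraph V), p.IsPath ∧ p.length ≤ k ∧ G ≤ H ∧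
      ¬ H.HasHamiltonianCycleThrough p.edges.toFinset ∧
      ∀ [DecidableRel H.Adj] (u v : V), u ≠ v → ¬ H.Adj u v →
        H.degree u + H.degree v + 1 ≤ Fintype.card V + k := by
  rw [IsPathHamiltonian] at hG
  push Not at hG
  obtain ⟨a, b, p, hp, hpk, hno⟩ := hG
  have hnot : ¬ G.HasHamiltonianCycleThrough p.edges.toFinset := by
    rintro ⟨x, c, hc, hcF⟩
    refine hno x c hc ⟨fun v _ ↦ c.mem_verts_toSubgraph.2 (hc.mem_support v), fun x y h ↦ ?_⟩
    rw [← Subgraph.mem_edgeSet, Walk.mem_edges_toSubgraph] at h ⊢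
    exact hcF _ (by simpa using h)
  obtain ⟨H, hGH, hH, hdeg⟩ := exists_le_degree_add_degree_le
    (by intro e he; exact p.edges_subset_edgeSet (by simpa using he)) hnot hV
  refine ⟨a, b, p, H, hp, hpk, hGH, hH, fun {_} u v hne huv ↦ ?_⟩
  have h1 := hdeg u v hne huv
  have h2 := p.edges.toFinset_card_le
  rw [Walk.length_edges] at h2
  omega

/-- A Chvátal-type degree condition satisfied by graphs that are not `k`-path Hamiltonian. -/
lemma exists_degree_le_of_not_isPathHamiltonian {G : SimpleGraph V} [DecidableRel G.Adj] {k : ℕ}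
    (hG : ¬ G.IsPathHamiltonian k) (hV : 3 ≤ Fintype.card V) :
    ∃ i, 2 * i + 1 ≤ Fintype.card V + k ∧ (∃ u, G.degree u ≤ i) ∧
      i ≤ #{v | G.degree v ≤ i} + k ∧
      Fintype.card V ≤ #{v | G.degree v + i + 1 ≤ Fintype.card V + k} + i := by
  classical
  obtain ⟨a, b, p, H, hp, hpk, hGH, hH, hdeg⟩ := exists_closure_of_not_isPathHamiltonian hG hV
  have hle : ∀ v, G.degree v ≤ H.degree v := fun v ↦ degree_le_of_le hGH
  have hex : ({q : V × V | q.1 ≠ q.2 ∧ ¬ H.Adj q.1 q.2} : Finset (V × V)).Nonempty := by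
    by_contra hcon
    rw [not_nonempty_iff_eq_empty, filter_eq_empty_iff] at hcon
    have hS : (Set.univ : Set V).Pairwise H.Adj := by
      intro x _ y _ hxy
      by_contra hn
      exact hcon (mem_univ (x, y)) ⟨hxy, hn⟩
    refine hH (Walk.IsPath.hasHamiltonianCycleThrough hS (p.mapLe hGH) (hp.mapLe hGH)
      trivial trivial (fun _ _ ↦ trivial) hV fun e he ↦ ?_)
    simpa using he
  -- Take a nonadjacent pair of maximal degree sum and let i be the smaller degree, at u.
  -- Non-neighbours of v then have degree at most i, and those of u degree at most that of v. The
  -- bound on the degree sum turns this into the two counts.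
  obtain ⟨⟨u, v⟩, huv, hmax⟩ := exists_max_image _ (fun q ↦ H.degree q.1 + H.degree q.2) hex
  simp only [mem_filter, mem_univ, true_and, Prod.forall] at huv hmax
  wlog hduv : H.degree u ≤ H.degree v generalizing u v
  · exact this v u ⟨huv.1.symm, fun h ↦ huv.2 h.symm⟩
      (fun x y h ↦ (hmax x y h).trans (by omega)) (by omega)
  have hsum := hdeg u v huv.1 huv.2
  have hcard : ∀ x, #({w | w ≠ x ∧ ¬ H.Adj x w} : Finset V) + H.degree x + 1 =
      Fintype.card V := by
    intro x
    have h1 : ({w | w ≠ x ∧ ¬ H.Adj x w} : Finset V) = (insert x (H.neighborFinset x))ᶜ := by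
      ext w
      simp
    have h2 := card_add_card_compl (insert x (H.neighborFinset x))
    rw [card_insert_of_notMem (by simp), card_neighborFinset_eq_degree] at h2
    rw [h1]
    omega
  refine ⟨H.degree u, by omega, ⟨u, hle u⟩, ?_, ?_⟩
  · have h1 : ({w | w ≠ v ∧ ¬ H.Adj v w} : Finset V) ⊆
        ({w | G.degree w ≤ H.degree u} : Finset V) := by
      intro w hw
      simp only [mem_filter, mem_univ, true_and] at hw ⊢
      have h2 : H.degree v + H.degree w ≤ H.degree u + H.degree v := hmax v w ⟨hw.1.symm, hw.2⟩
      have := hle w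
      omega
    have := card_le_card h1
    have := hcard v
    omega
  · have h1 : insert u ({w | w ≠ u ∧ ¬ H.Adj u w} : Finset V) ⊆
        ({w | G.degree w + H.degree u + 1 ≤ Fintype.card V + k} : Finset V) := by
      intro w hw
      simp only [mem_insert, mem_filter, mem_univ, true_and] at hw ⊢
      have := hle w
      change H.degree u ≤ H.degree v at hduv
      change H.degree u + H.degree v + 1 ≤ _ at hsum
      rcases hw with rfl | hw
      · omega
      · have h2 : H.degree u + H.degree w ≤ H.degree u + H.degree v := hmax u w ⟨hw.1.symm, hw.2⟩
        omega
    have h2 := card_le_card h1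
    rw [card_insert_of_notMem (by simp)] at h2
    have := hcard u
    omega

/-- Lowering the weight on `A` interpolates between keeping and deleting it, and the best
intermediate weight gives n(s + k) - 3/4 (s + k)². -/
lemma CliqueFree.card_edgeFinset_lt_of_degree_le {G : SimpleGraph V} [DecidableRel G.Adj]
    (hG : G.CliqueFree 4) {A : Finset V} {k s : ℕ} (hA : #A = s)
    (hdeg : ∀ v ∈ A, G.degree v ≤ s + k) (hn : 6 * k + 26 ≤ Fintype.card V)
    (hs : 2 * s + k + 1 ≤ Fintype.card V) (hs' : 2 * Fintype.card V ≤ 5 * s + 3 * k) :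
    #G.edgeFinset < #(turanGraph (Fintype.card V - 1) 3).edgeFinset + (k + 1) := by
  set n := Fintype.card V
  have hs0 : (0 : ℝ) < s := by
    have : 0 < s := by omega
    exact_mod_cast this
  have h1 : 2 * (n : ℝ) ≤ 5 * s + 3 * k := by exact_mod_cast hs'
  have h2 : 3 * ((s : ℝ) + k) ≤ 2 * n := by
    have : 3 * (s + k) ≤ 2 * n := by omega
    exact_mod_cast this
  -- This c minimises the resulting bound: the total weight becomes 3/2 (s + k). The two ranges for
  -- s are what put c in [0, 1].
  set c : ℝ := (n - 3 / 2 * (s + k)) / s with hc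
  have hcs : c * s = n - 3 / 2 * (s + k) := div_mul_cancel₀ _ hs0.ne'
  have hc0 : 0 ≤ c := div_nonneg (by linarith) hs0.le
  have hc1 : c ≤ 1 := (div_le_one hs0).2 (by linarith)
  have key := CliqueFree.mul_card_edgeFinset_sub_le (r := 3) hG A hc0 hc1
  rw [hA, hcs] at key
  have hsum : ∑ v ∈ A, (G.degree v : ℝ) ≤ s * (s + k) := by
    have := sum_le_card_nsmul A (fun v ↦ (G.degree v : ℝ)) (s + k)
      fun v hv ↦ by exact_mod_cast hdeg v hv
    rwa [hA, nsmul_eq_mul] at this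
  have h3 := mul_sub_lt_card_edgeFinset_turanGraph_three (i := s + k) hn (by omega)
  have h4 : c * ∑ v ∈ A, (G.degree v : ℝ) ≤ (n - 3 / 2 * (s + k)) * (s + k) := by
    rw [← hcs, mul_assoc]
    exact mul_le_mul_of_nonneg_left hsum hc0
  have h5 : (#G.edgeFinset : ℝ) <
      (#(turanGraph (n - 1) 3).edgeFinset + (k + 1) : ℕ) := by
    refine lt_of_le_of_lt ?_ h3
    push_cast at key ⊢
    change _ * (2 * _ - 2 * c * _) ≤ (3 - 1) * ((n : ℝ) - _) ^ 2 at key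
    nlinarith
  exact_mod_cast h5

theorem CliqueFree.card_edgeFinset_le_of_not_isPathHamiltonian {G : SimpleGraph V}
    [DecidableRel G.Adj] {r k : ℕ} (hr : 3 ≤ r) (hG : G.CliqueFree (r + 1))
    (hk : ¬ G.IsPathHamiltonian k)
    (hn : (if r = 3 then 6 * k + 26 else if r ≤ 7 then 5 * k + 11 else 2 * k + 9) ≤
      Fintype.card V) :
    #G.edgeFinset ≤ #(turanGraph (Fintype.card V - 1) r).edgeFinset + (k + 1) ∧
      ((if r = 3 then 6 * k + 26 else if r ≤ 7 then 6 * k + 2 * r + 3 else 2 * k + 2 * r) ≤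
        Fintype.card V →
      #G.edgeFinset = #(turanGraph (Fintype.card V - 1) r).edgeFinset + (k + 1) →
      (∃ u, G.degree u ≤ k + 1) ∨
        (r = 4 ∧ k = 0 ∧ Fintype.card V = 11 ∧ 6 ≤ #{v | G.degree v ≤ 5})) := by
  have hV : 3 ≤ Fintype.card V := by split_ifs at hn <;> omega
  obtain ⟨i, hi, ⟨u, hu⟩, hA, hB⟩ := exists_degree_le_of_not_isPathHamiltonian hk hV
  have hu1 := hG.card_edgeFinset_le_add_sum_degree {u}
  rw [card_singleton, sum_singleton] at hu1
  by_cases hik : i ≤ k + 1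
  · exact ⟨by omega, fun _ _ ↦ Or.inl ⟨u, by omega⟩⟩
  obtain ⟨s, rfl⟩ : ∃ s, i = s + k := ⟨i - k, by omega⟩
  obtain ⟨A, hAsub, hAs⟩ := exists_subset_card_eq (show s ≤ #{v | G.degree v ≤ s + k} by omega)
  have hdeg : ∀ v ∈ A, G.degree v ≤ s + k := fun v hv ↦ by simpa using hAsub hv
  have hs : 2 ≤ s := by omega
  have hs' : 2 * s + k + 1 ≤ Fintype.card V := by omega
  have hsum : ∑ v ∈ A, G.degree v ≤ s * (s + k) := by
    have := sum_le_card_nsmul A _ _ hdeg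
    simpa [hAs] using this
  have hA1 := hG.card_edgeFinset_le_add_sum_degree A
  rw [hAs] at hA1
  by_cases h3 : r = 3
  · subst h3
    rw [if_pos rfl] at hn
    have hlt : #G.edgeFinset < #(turanGraph (Fintype.card V - 1) 3).edgeFinset + (k + 1) := by
      by_cases hsk : 5 * s + 3 * k < 2 * Fintype.card V
      · have := card_edgeFinset_turanGraph_three_add_mul_lt hn hs hsk
        omega
      · exact CliqueFree.card_edgeFinset_lt_of_degree_le hG hAs hdeg hn hs' (by omega)
    exact ⟨hlt.le, fun _ h ↦ absurd h hlt.ne⟩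
  · rw [if_neg h3] at hn ⊢
    have h4 : 4 ≤ r := by omega
    refine ⟨?_, fun hn2 heq ↦ ?_⟩
    · have := card_edgeFinset_turanGraph_add_mul_le h4 hn hs hs'
      omega
    · by_cases hex : r = 4 ∧ k = 0 ∧ Fintype.card V = 11 ∧ s = 5
      · obtain ⟨rfl, rfl, h11, rfl⟩ := hex
        -- The first Chvátal count gives only five such vertices; the second, with i = 5 and n = 11,
        -- gives six.
        refine Or.inr ⟨rfl, rfl, h11, ?_⟩
        rw [h11] at hB
        have : #{v | G.degree v + (5 + 0) + 1 ≤ 11 + 0} = #{v | G.degree v ≤ 5} :=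
          congrArg card (filter_congr fun v _ ↦ by omega)
        omega
      · have := card_edgeFinset_turanGraph_add_mul_lt h4 hn2 hs hs' hex
        omega

end Chvatal

/-! ### The extremal family: one vertex added to a Turán graph -/

section TuranPlusVertex

variable {V : Type*} [Fintype V] [DecidableEq V]

/-- Let q be a path spanning N(v). Its inner vertices already have both their cycle neighbours on q,
so a Hamiltonian cycle containing q joins v to the two ends of q and closes on k + 2 vertices, fewer
than all. -/
lemma not_isPathHamiltonian_of_traceable {G : SimpleGraph V} [DecidableRel G.Adj] {v : V} {k : ℕ}
    (hdeg : G.degree v = k + 1) (hT : (G.induce (G.neighborSet v)).Traceable)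
    (hV : k + 2 < Fintype.card V) : ¬ G.IsPathHamiltonian k := by
  intro hPH
  obtain ⟨a', b', p, hp⟩ := hT
  obtain ⟨a, b, q, hq, hlen, hsupp⟩ : ∃ (a b : V) (q : G.Walk a b), q.IsPath ∧ q.length = k ∧
      ∀ x, x ∈ q.support ↔ G.Adj v x := by
    refine ⟨_, _, p.map (Embedding.induce (G := G) (G.neighborSet v)).toHom,
      hp.isPath.map (Embedding.induce (G := G) _).injective, ?_, ?_⟩
    · rw [Walk.length_map, hp.length_eq, card_neighborSet_eq_degree, hdeg]
      rfl
    · intro x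
      rw [Walk.support_map, List.mem_map]
      constructor
      · rintro ⟨y, -, rfl⟩
        exact y.2
      · intro hx
        exact ⟨⟨x, hx⟩, hp.mem_support _, rfl⟩
  obtain ⟨c₀, c, hc, hqc⟩ := hPH a b q hq hlen.le
  have hc2 : ∀ x, (c.toSubgraph.neighborSet x).ncard = 2 := fun x ↦
    hc.isCycle.ncard_neighborSet_toSubgraph_eq_two (hc.mem_support x)
  have hfin : ∀ x, (c.toSubgraph.neighborSet x).Finite := fun x ↦ Set.toFinite _
  have hqv : ∀ x y, q.toSubgraph.Adj x y → G.Adj v y := by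
    intro x y h
    rw [← hsupp, ← Walk.mem_verts_toSubgraph]
    exact h.snd_mem
  have hint : ∀ j, j ≠ 0 → j < q.length → ∀ y, c.toSubgraph.Adj (q.getVert j) y → G.Adj v y := by
    intro j hj0 hj y hy
    have hsub : q.toSubgraph.neighborSet (q.getVert j) ⊆ c.toSubgraph.neighborSet (q.getVert j) :=
      fun z hz ↦ hqc.2 hz
    have := Set.eq_of_subset_of_ncard_le hsub
      (by rw [hc2, hq.ncard_neighborSet_toSubgraph_internal_eq_two hj0 hj]) (hfin _)
    have hy' : y ∈ c.toSubgraph.neighborSet (q.getVert j) := hy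
    rw [← this] at hy'
    exact hqv _ y hy'
  have hends : c.toSubgraph.neighborSet v ⊆ {a, b} := by
    intro y hy
    have hvy : G.Adj v y := hy.adj_sub
    obtain ⟨j, rfl, hj⟩ := Walk.mem_support_iff_exists_getVert.1 ((hsupp y).2 hvy)
    by_cases hj0 : j = 0
    · simp [hj0]
    by_cases hjl : j = q.length
    · simp [hjl]
    exact absurd (hint j hj0 (by omega) v hy.symm) (G.irrefl)
  -- This settles k = 0, where v would have a single neighbour on the cycle.
  have hab : a ≠ b := by
    rintro rfl
    have := Set.ncard_le_ncard hends
    rw [hc2, Set.pair_eq_singleton, Set.ncard_singleton] at this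
    omega
  have hends' : c.toSubgraph.neighborSet v = {a, b} :=
    Set.eq_of_subset_of_ncard_le hends (by rw [hc2, Set.ncard_pair hab])
  have hnil : ¬ q.Nil := fun h ↦ hab h.eq
  have hend : ∀ x z, c.toSubgraph.Adj v x → q.toSubgraph.Adj x z →
      ∀ y, c.toSubgraph.Adj x y → y = v ∨ G.Adj v y := by
    intro x z hvx hxz y hy
    have hvz := hqv x z hxz
    have hsub : {v, z} ⊆ c.toSubgraph.neighborSet x := by
      rintro w (rfl | rfl)
      · exact hvx.symm
      · exact hqc.2 hxz
    have := Set.eq_of_subset_of_ncard_le hsub (by rw [hc2, Set.ncard_pair hvz.ne])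
    have hy' : y ∈ ({v, z} : Set V) := this.symm ▸ hy
    rcases hy' with rfl | rfl
    · exact Or.inl rfl
    · exact Or.inr hvz
  have hclosed : ∀ x y, (x = v ∨ G.Adj v x) → c.toSubgraph.Adj x y → y = v ∨ G.Adj v y := by
    rintro x y (rfl | hvx) hxy
    · exact Or.inr hxy.adj_sub
    · obtain ⟨j, rfl, hj⟩ := Walk.mem_support_iff_exists_getVert.1 ((hsupp x).2 hvx)
      by_cases hj0 : j = 0
      · subst hj0
        rw [Walk.getVert_zero] at hxy
        refine hend a q.snd (hends'.symm ▸ Set.mem_insert a {b} : a ∈ c.toSubgraph.neighborSet v)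
          (q.toSubgraph_adj_snd hnil) y hxy
      by_cases hjl : j = q.length
      · subst hjl
        rw [Walk.getVert_length] at hxy
        refine hend b q.penultimate
          (hends'.symm ▸ Set.mem_insert_of_mem a rfl : b ∈ c.toSubgraph.neighborSet v)
          (q.toSubgraph_adj_penultimate hnil).symm y hxy
      exact Or.inr (hint j hj0 (by omega) y hxy)
  have hall : ∀ x, x = v ∨ G.Adj v x := by
    intro x
    have hv : v ∈ c.support := hc.mem_support v
    have hx : x ∈ (c.rotate v hv).support := (hc.rotate hv).mem_support x
    obtain ⟨i, rfl, hi⟩ := Walk.mem_support_iff_exists_getVert.1 hx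
    clear hx
    induction i with
    | zero => simp
    | succ i ih =>
      refine hclosed _ _ (ih (by omega)) ?_
      rw [← Walk.toSubgraph_rotate c hv]
      exact Walk.toSubgraph_adj_getVert _ hi
  have : (univ : Finset V) ⊆ insert v (G.neighborFinset v) := fun x _ ↦ by simpa using hall x
  have := card_le_card this
  rw [card_insert_of_notMem (by simp), card_neighborFinset_eq_degree, card_univ] at this
  omega

/-- Once w is appended, u is an inner vertex, and both ends and everything outside lie in the
clique. -/
lemma Walk.IsPath.hasHamiltonianCycleThrough_of_adj_end {H : SimpleGraph V} {u : V}
    (hS : ({u}ᶜ : Set V).Pairwise H.Adj) {a w : V} (q : H.Walk a u) (hq : q.IsPath) (hau : a ≠ u)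
    (huw : H.Adj u w) (hw : w ∉ q.support) (hV : 3 ≤ Fintype.card V) {F : Finset (Sym2 V)}
    (hF : ∀ e ∈ F, e ∈ q.edges) : H.HasHamiltonianCycleThrough F := by
  refine (hq.concat hw huw).hasHamiltonianCycleThrough hS _ hau huw.ne' ?_ hV ?_
  · rintro x hx rfl
    simp [Walk.support_concat] at hx
  · intro e he
    simp [Walk.edges_concat, hF e he]

/-- If `H - u` is complete, the only paths of length at most `k` that need not extend to a
Hamiltonian cycle are those avoiding `u` and covering its neighbourhood. -/
lemma Walk.IsPath.notMem_support_and_subset {H : SimpleGraph V} {u : V} {N : Finset V} {k : ℕ}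
    (hS : ({u}ᶜ : Set V).Pairwise H.Adj) (hN : ∀ w ∈ N, H.Adj u w) (hNk : #N = k + 1)
    (hk : 1 ≤ k) {a b : V} (q : H.Walk a b) (hq : q.IsPath) (hlen : q.length ≤ k)
    {F : Finset (Sym2 V)} (hF : ∀ e ∈ F, e ∈ q.edges) (hH : ¬ H.HasHamiltonianCycleThrough F)
    (hV : 3 ≤ Fintype.card V) :
    u ∉ q.support ∧ N ⊆ q.support.toFinset := by
  have hcard : #q.support.toFinset = q.length + 1 := by
    rw [List.toFinset_card_of_nodup hq.support_nodup, Walk.length_support]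
  have huN : u ∉ N := fun h ↦ (hN u h).ne rfl
  -- A path ending at u with at most k + 1 vertices cannot contain all of `N` as well, so it can be
  -- continued from u. The trivial path at u needs two neighbours instead, hence k ≥ 1.
  have hend : ∀ x (q' : H.Walk x u), q'.IsPath → q'.length ≤ k → (∀ e ∈ F, e ∈ q'.edges) →
      False := by
    intro x q' hq' hlen' hF'
    have hcard' : #q'.support.toFinset = q'.length + 1 := by
      rw [List.toFinset_card_of_nodup hq'.support_nodup, Walk.length_support]
    by_cases hxu : x = u
    · subst hxu
      obtain ⟨w, hw, w', hw', hne⟩ := one_lt_card.1 (show 1 < #N by omega)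
      have hnil := Walk.length_eq_zero_iff.2 (Walk.isPath_iff_nil.1 hq')
      have hFe : ∀ e, e ∉ F := by
        intro e he
        have := List.length_pos_of_mem (hF' e he)
        rw [Walk.length_edges] at this
        omega
      refine hH (Walk.IsPath.hasHamiltonianCycleThrough_of_adj_end hS
        (Walk.cons (hN w hw).symm Walk.nil) ?_ (hN w hw).ne' (hN w' hw') ?_ hV
        fun e he ↦ absurd he (hFe e))
      · simpa using (hN w hw).ne'
      · simpa using ⟨hne.symm, (hN w' hw').ne'⟩
    · obtain ⟨w, hw, hwq⟩ : ∃ w ∈ N, w ∉ q'.support := by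
        by_contra! hcon
        have hsub : insert u N ⊆ q'.support.toFinset := by
          intro z hz
          rw [mem_insert] at hz
          rcases hz with rfl | hz
          · simp
          · simpa using hcon z hz
        have := card_le_card hsub
        rw [card_insert_of_notMem huN] at this
        omega
      exact hH (hq'.hasHamiltonianCycleThrough_of_adj_end hS _ hxu (hN w hw) hwq hV hF')
  have hu : u ∉ q.support := by
    intro hu
    by_cases hb : b = u
    · subst hb
      exact hend a q hq hlen hF
    by_cases ha : a = u
    · subst ha
      exact hend b q.reverse hq.reverse (by simpa using hlen) (by simpa using hF)
    exact hH (hq.hasHamiltonianCycleThrough hS _ ha hb (by rintro x hx rfl; exact hx hu) hV hF)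
  refine ⟨hu, fun w hw ↦ ?_⟩
  rw [List.mem_toFinset]
  by_contra hwq
  have hfin : ∀ x w' (q' : H.Walk x w'), q'.IsPath → (∀ e ∈ F, e ∈ q'.edges) →
      u ∉ q'.support → w' ∈ N → w ∉ q'.support → False := by
    intro x w' q' hq' hF' hu' hw' hwq'
    refine hH ((hq'.concat hu' (hN w' hw').symm).hasHamiltonianCycleThrough_of_adj_end hS _
      ?_ (hN w hw) ?_ hV ?_)
    · rintro rfl
      simp at hu'
    · simpa [Walk.support_concat, hwq'] using (hN w hw).ne'
    · intro e he
      simp [Walk.edges_concat, hF' e he]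
  -- The path has at most k - 1 inner vertices, while `N` without w has k elements. So some w' is an
  -- end of the path or off it, and the path can be made to end at w' and continue through u to w.
  obtain ⟨w', hw', hw'q⟩ : ∃ w' ∈ N.erase w, w' ∉ q.support.toFinset \ {a, b} := by
    by_contra! hcon
    have h1 := card_le_card (show N.erase w ⊆ _ from hcon)
    rw [card_erase_of_mem hw, card_sdiff_of_subset (by
      intro z hz
      rw [mem_insert, mem_singleton] at hz
      rcases hz with rfl | rfl <;> simp)] at h1
    by_cases hab : a = b
    · subst hab
      have := Walk.length_eq_zero_iff.2 (Walk.isPath_iff_nil.1 hq)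
      simp at h1
      omega
    · rw [card_pair hab] at h1
      omega
  rw [mem_erase] at hw'
  by_cases hw's : w' ∈ q.support
  · simp only [mem_sdiff, List.mem_toFinset, hw's, mem_insert, mem_singleton, true_and,
      not_not] at hw'q
    rcases hw'q with rfl | rfl
    · exact hfin b w' q.reverse hq.reverse (by simpa using hF) (by simpa using hu) hw'.2
        (by simpa using hwq)
    · exact hfin a w' q hq hF hu hw'.2 hwq
  · have hbw : H.Adj b w' := hS (by rintro rfl; simp at hu) (hN w' hw'.2).ne'
      (by rintro rfl; simp at hw's)
    refine hfin a w' (q.concat hbw) (hq.concat hw's hbw) ?_ ?_ hw'.2 ?_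
    · intro e he
      simp [Walk.edges_concat, hF e he]
    · simpa [Walk.support_concat, hu] using (hN w' hw'.2).ne
    · simpa [Walk.support_concat, hwq] using hw'.1.symm

/-- For k ≥ 1 the bad path covers N(u) and has at most k + 1 vertices, so it is itself a Hamiltonian
path of N(u). -/
lemma traceable_induce_neighborSet {G H : SimpleGraph V} [DecidableRel G.Adj] (hGH : G ≤ H)
    {u : V} {k : ℕ} (hdeg : G.degree u = k + 1) (hS : ({u}ᶜ : Set V).Pairwise H.Adj)
    {a b : V} (p : G.Walk a b) (hp : p.IsPath) (hlen : p.length ≤ k)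
    (hH : ¬ H.HasHamiltonianCycleThrough p.edges.toFinset) (hV : 3 ≤ Fintype.card V) :
    (G.induce (G.neighborSet u)).Traceable := by
  rcases Nat.eq_zero_or_pos k with rfl | hk
  · rw [← card_neighborFinset_eq_degree, zero_add, card_eq_one] at hdeg
    obtain ⟨w, hw⟩ := hdeg
    have hmem : ∀ x, x ∈ G.neighborSet u ↔ x = w := by
      intro x
      rw [← mem_singleton, ← hw, mem_neighborFinset, mem_neighborSet]
    have : Subsingleton (G.neighborSet u) :=
      ⟨fun x y ↦ Subtype.ext (((hmem _).1 x.2).trans ((hmem _).1 y.2).symm)⟩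
    exact ⟨⟨w, (hmem w).2 rfl⟩, _, Walk.nil, Walk.IsHamiltonian.of_subsingleton⟩
  · have key := (hp.mapLe hGH).notMem_support_and_subset (N := G.neighborFinset u) hS
      (fun w hw ↦ hGH ((G.mem_neighborFinset u w).1 hw))
      (by rw [card_neighborFinset_eq_degree, hdeg]) hk _ (by simpa using hlen)
      (F := p.edges.toFinset) (by intro e he; simpa using he) hH hV
    have hcard : #p.support.toFinset = p.length + 1 := by
      rw [List.toFinset_card_of_nodup hp.support_nodup, Walk.length_support]
    have hsub : G.neighborFinset u ⊆ p.support.toFinset := by simpa using key.2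
    have heq := eq_of_subset_of_card_le hsub
      (by rw [hcard, card_neighborFinset_eq_degree, hdeg]; omega)
    have hsupp : ∀ x ∈ p.support, x ∈ G.neighborSet u := by
      intro x hx
      rw [← List.mem_toFinset, ← heq] at hx
      simpa using hx
    have hpath : (p.induce _ hsupp).IsPath := by
      refine Walk.IsPath.mk' (List.Nodup.of_map Subtype.val ?_)
      rw [Walk.support_induce, List.attachWith_map_subtype_val]
      exact hp.support_nodup
    refine ⟨_, _, p.induce _ hsupp, hpath.isHamiltonian_of_mem fun x ↦ ?_⟩
    have : x.1 ∈ p.support := by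
      rw [← List.mem_toFinset, ← heq, mem_neighborFinset]
      exact x.2
    rw [Walk.support_induce]
    simpa using this

lemma CliqueFree.nonempty_iso_turanGraph_of_card_eq {W : Type*} [Fintype W] {G : SimpleGraph W}
    [DecidableRel G.Adj] {r m : ℕ} (hr : 0 < r) (hG : G.CliqueFree (r + 1))
    (hm : Fintype.card W = m) (h : #G.edgeFinset = #(turanGraph m r).edgeFinset) :
    Nonempty (G ≃g turanGraph m r) := by
  subst hm
  rw [← isTuranMaximal_iff_nonempty_iso_turanGraph hr]
  refine ⟨hG, fun G' _ hG' ↦ ?_⟩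
  rw [h]
  exact hG'.card_edgeFinset_le_turanGraph

lemma card_edgeFinset_eq_induce_compl_singleton_add (G : SimpleGraph V) [DecidableRel G.Adj]
    (v : V) : #G.edgeFinset = #(G.induce ({v}ᶜ : Set V)).edgeFinset + G.degree v := by
  have h := G.card_edgeFinset_deleteIncidenceSet v
  rw [card_edgeFinset_induce_compl_singleton, h]
  have h2 : G.degree v ≤ #G.edgeFinset := by
    rw [← card_incidenceFinset_eq_degree]
    exact card_le_card (G.incidenceFinset_subset v)
  omega

lemma IsTuranPlusTraceableVertex.not_isPathHamiltonian_and_card {G : SimpleGraph V}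
    [DecidableRel G.Adj] {n r k : ℕ} (h : G.IsTuranPlusTraceableVertex n r k) (hn : k + 2 < n) :
    ¬ G.IsPathHamiltonian k ∧
      #G.edgeFinset = #(turanGraph (n - 1) r).edgeFinset + (k + 1) := by
  obtain ⟨hV, -, v, ⟨φ⟩, hdeg, hT⟩ := h
  refine ⟨not_isPathHamiltonian_of_traceable hdeg hT (hV ▸ hn), ?_⟩
  rw [G.card_edgeFinset_eq_induce_compl_singleton_add v, hdeg, φ.card_edgeFinset_eq]

lemma CliqueFree.isTuranPlusTraceableVertex {G : SimpleGraph V} [DecidableRel G.Adj] {r k : ℕ}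
    (hr : 3 ≤ r) (hG : G.CliqueFree (r + 1)) (hk : ¬ G.IsPathHamiltonian k)
    (hn : 3 * k + 11 ≤ Fintype.card V ∨ 8 ≤ r ∧ 2 * k + 16 ≤ Fintype.card V)
    (he : #G.edgeFinset = #(turanGraph (Fintype.card V - 1) r).edgeFinset + (k + 1))
    {u : V} (hu : G.degree u ≤ k + 1) :
    G.IsTuranPlusTraceableVertex (Fintype.card V) r k := by
  classical
  have hV : 3 ≤ Fintype.card V := by omega
  have h1 := G.card_edgeFinset_eq_induce_compl_singleton_add u
  have hG' := hG.comap (Embedding.induce (G := G) ({u}ᶜ : Set V)).isContained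
  have hcard : Fintype.card ({u}ᶜ : Set V) = Fintype.card V - 1 := by
    rw [Fintype.card_compl_set]; simp
  have h2 := hG'.card_edgeFinset_le_turanGraph
  rw [hcard] at h2
  have hdeg : G.degree u = k + 1 := by omega
  refine ⟨rfl, hG, u, hG'.nonempty_iso_turanGraph_of_card_eq (by omega) hcard (by omega), hdeg, ?_⟩
  obtain ⟨a, b, p, H, hp, hpk, hGH, hH, hsum⟩ := exists_closure_of_not_isPathHamiltonian hk hV
  refine traceable_induce_neighborSet hGH hdeg ?_ p hp hpk hH hV
  -- Deleting u and x together and using equality gives x nearly Turán degree. Two such degrees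
  -- exceed the closure bound, so `H` is complete away from u.
  have hlow : ∀ x, x ≠ u → Fintype.card V ≤ H.degree x + 2 + (Fintype.card V - 2) / r := by
    intro x hx
    have h3 := hG.card_edgeFinset_le_add_sum_degree {u, x}
    rw [card_pair hx.symm, sum_pair hx.symm, he] at h3
    have h4 := card_edgeFinset_turanGraph_succ (r := r) (by omega) (Fintype.card V - 2)
    rw [show Fintype.card V - 2 + 1 = Fintype.card V - 1 by omega] at h4
    have h5 : G.degree x ≤ H.degree x := degree_le_of_le hGH
    omega
  intro x hx y hy hxy
  by_contra hadj
  have h3 := hsum x y hxy hadj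
  have h4 := hlow x hx
  have h5 := hlow y hy
  rcases hn with hn | ⟨hr8, hn⟩
  · have h6 : (Fintype.card V - 2) / r ≤ (Fintype.card V - 2) / 3 :=
      Nat.div_le_div_left hr (by norm_num)
    omega
  · have h6 : (Fintype.card V - 2) / r ≤ (Fintype.card V - 2) / 8 :=
      Nat.div_le_div_left hr8 (by norm_num)
    omega

end TuranPlusVertex

/-! ### The exceptional graph -/

section K6221

/-- Predecessors on the cycle of vertices of `A` are distinct and lie outside `A`. -/
lemma Walk.IsHamiltonianCycle.two_mul_card_le {V : Type*} [Fintype V] [DecidableEq V]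
    {G : SimpleGraph V} {a : V} {c : G.Walk a a} (hc : c.IsHamiltonianCycle) {A : Finset V}
    (hA : ∀ x ∈ A, ∀ y ∈ A, ¬ G.Adj x y) : 2 * #A ≤ Fintype.card V := by
  set I := {i ∈ range c.length | c.getVert (i + 1) ∈ A}
  have h1 : #A ≤ #I := by
    refine (card_le_card fun x hx ↦ ?_).trans (card_image_le (f := fun i ↦ c.getVert (i + 1)))
    have hmem := hc.isHamiltonian_tail.mem_support x
    obtain ⟨i, hi, hil⟩ := Walk.mem_support_iff_exists_getVert.1 hmem
    rw [Walk.getVert_tail] at hi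
    have := Walk.length_tail_add_one hc.isCycle.not_nil
    refine mem_image.2 ⟨i, mem_filter.2 ⟨mem_range.2 (by omega), by rwa [hi]⟩, hi⟩
  have h2 : #I ≤ #Aᶜ := by
    refine card_le_card_of_injOn c.getVert ?_ ?_
    · intro i hi
      simp only [I, coe_filter, mem_range, Set.mem_ofPred_eq] at hi
      rw [mem_coe, mem_compl]
      exact fun h ↦ hA _ h _ hi.2 (c.adj_getVert_succ hi.1)
    · intro i hi j hj e
      simp only [I, coe_filter, mem_range, Set.mem_ofPred_eq] at hi hj
      exact hc.isCycle.getVert_injOn' (show i ≤ c.length - 1 by omega)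
        (show j ≤ c.length - 1 by omega) e
  rw [card_compl] at h2
  have := card_le_univ A
  omega

lemma card_edgeFinset_K6221 : #K6221.edgeFinset = 38 := by
  decide +kernel

variable {V : Type*} [Fintype V] [DecidableEq V] {G : SimpleGraph V}

lemma not_isPathHamiltonian_of_iso_K6221 (φ : G ≃g K6221) : ¬ G.IsPathHamiltonian 0 := by
  intro h
  obtain ⟨a, c, hc, -⟩ := h (φ.symm ⟨0, ⟨0, by decide⟩⟩) _ Walk.nil (by simp) (by simp)
  have hA := hc.two_mul_card_le (A := univ.image fun i : Fin 6 ↦ φ.symm ⟨0, i⟩) (by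
    intro x hx y hy
    obtain ⟨i, -, rfl⟩ := mem_image.1 hx
    obtain ⟨j, -, rfl⟩ := mem_image.1 hy
    rw [φ.symm.map_adj_iff]
    simp)
  rw [card_image_of_injective _ (by
    intro i j h
    exact eq_of_heq (Sigma.mk.inj (φ.symm.injective h)).2), card_univ, φ.card_eq] at hA
  revert hA
  decide

/-- Let B be the complement of six vertices of degree at most 5. Edge counting finds one of the six
joined to all of B, so B is K₄-free with at most 8 edges. Then 76 = 2 · 8 + 6 · 10 is tight: the six
are independent and complete to B, and B is T_3(5) = K_{2,2,1}. -/
lemma CliqueFree.nonempty_iso_K6221 [DecidableRel G.Adj] (hG : G.CliqueFree 5) (hV : Fintype.card V = 11)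
    (he : #G.edgeFinset = 38) (hdeg : 6 ≤ #{v | G.degree v ≤ 5}) : Nonempty (G ≃g K6221) := by
  obtain ⟨A, hAsub, hA⟩ := exists_subset_card_eq hdeg
  have hA5 : ∀ v ∈ A, G.degree v ≤ 5 := fun v hv ↦ by simpa using hAsub hv
  have hcB : #Aᶜ = 5 := by rw [card_compl, hA, hV]
  have hsplit := G.two_mul_card_edgeFinset_eq A
  rw [he] at hsplit
  have hB9 := CliqueFree.card_edgeFinset_induce_compl_le (r := 4) hG A
  have hT4 : #(turanGraph 5 4).edgeFinset = 9 := by rw [card_edgeFinset_turanGraph]; rfl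
  have hT3 : #(turanGraph 5 3).edgeFinset = 8 := by rw [card_edgeFinset_turanGraph]; rfl
  rw [hV, hA, hT4] at hB9
  have hle : ∀ v, #{w ∈ Aᶜ | G.Adj v w} ≤ 5 := fun v ↦ (card_filter_le _ _).trans hcB.le
  -- Otherwise every summand is at most 9, and 2 · 9 + 6 · 9 = 72 < 76.
  obtain ⟨a, ha, haB⟩ : ∃ a ∈ A, #{w ∈ Aᶜ | G.Adj a w} = 5 := by
    by_contra! hcon
    have h9 : ∀ v ∈ A, G.degree v + #{w ∈ Aᶜ | G.Adj v w} ≤ 9 := fun v hv ↦ by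
      have := hA5 v hv
      have := hle v
      have := hcon v hv
      omega
    have := sum_le_card_nsmul A _ _ h9
    rw [hA, smul_eq_mul] at this
    omega
  have hfull : ∀ v, #{w ∈ Aᶜ | G.Adj v w} = 5 → ∀ w ∉ A, G.Adj v w := by
    intro v hv w hw
    have := eq_of_subset_of_card_le (filter_subset (G.Adj v) Aᶜ) (hcB.le.trans hv.ge)
    have hw' : w ∈ Aᶜ := mem_compl.2 hw
    rw [← this, mem_filter] at hw'
    exact hw'.2
  have hB4 : (G.induce ((Aᶜ : Finset V) : Set V)).CliqueFree 4 := by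
    intro t ht
    refine hG (insert a (t.map (Function.Embedding.subtype _))) ⟨?_, ?_⟩
    · rw [coe_insert, isClique_insert]
      constructor
      · intro x hx y hy hxy
        simp only [coe_map, Set.mem_image, mem_coe] at hx hy
        obtain ⟨x, hx, rfl⟩ := hx
        obtain ⟨y, hy, rfl⟩ := hy
        exact ht.1 hx hy (by rintro rfl; exact hxy rfl)
      · intro x hx _
        simp only [coe_map, Set.mem_image, mem_coe] at hx
        obtain ⟨x, hx, rfl⟩ := hx
        exact hfull a haB _ (by simpa using x.2)
    · rw [card_insert_of_notMem, card_map, ht.2]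
      intro h
      simp only [mem_map] at h
      obtain ⟨x, -, rfl⟩ := h
      have := x.2
      simp at this
      exact this ha
  have hcardB : Fintype.card ((Aᶜ : Finset V) : Set V) = 5 := by
    rw [← hcB]; exact Fintype.card_coe _
  have hB8 := hB4.card_edgeFinset_le_turanGraph (r := 3)
  rw [hcardB, hT3] at hB8
  have hsum : ∀ v ∈ A, G.degree v + #{w ∈ Aᶜ | G.Adj v w} = 10 := by
    have h10 : ∀ v ∈ A, G.degree v + #{w ∈ Aᶜ | G.Adj v w} ≤ 10 := fun v hv ↦ by
      have := hA5 v hv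
      have := hle v
      omega
    have htot := sum_le_card_nsmul A _ _ h10
    rw [hA, smul_eq_mul] at htot
    refine (sum_eq_sum_iff_of_le h10).1 ?_
    rw [sum_const, hA, smul_eq_mul]
    omega
  have hE8 : #(G.induce ((Aᶜ : Finset V) : Set V)).edgeFinset = 8 := by
    rw [sum_congr rfl hsum, sum_const, hA, smul_eq_mul] at hsplit
    omega
  have hadj : ∀ v ∈ A, ∀ w, G.Adj v w ↔ w ∉ A := by
    intro v hv w
    have h1 := hsum v hv
    have h2 := hA5 v hv
    have h3 := hle v
    refine ⟨fun h ↦ ?_, hfull v (by omega) w⟩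
    have hsub : {w ∈ Aᶜ | G.Adj v w} ⊆ G.neighborFinset v := fun x hx ↦ by
      simpa using (mem_filter.1 hx).2
    have heq := eq_of_subset_of_card_le hsub (by rw [card_neighborFinset_eq_degree]; omega)
    have hw : w ∈ G.neighborFinset v := by simpa using h
    rw [← heq, mem_filter, mem_compl] at hw
    exact hw.1
  obtain ⟨ψ⟩ := CliqueFree.nonempty_iso_turanGraph_of_card_eq (r := 3) (by norm_num) hB4 hcardB
    (hE8.trans hT3.symm)
  let eA : A ≃ Fin 6 := A.equivFinOfCardEq hA
  -- Residues mod 3, the parts of T_3(5), go to parts 1, 2, 3; part 0 is kept for `A`.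
  let g : Fin 5 → Σ i : Fin 4, Fin (![6, 2, 2, 1] i) :=
    ![⟨1, ⟨0, by decide⟩⟩, ⟨2, ⟨0, by decide⟩⟩, ⟨3, ⟨0, by decide⟩⟩, ⟨1, ⟨1, by decide⟩⟩,
      ⟨2, ⟨1, by decide⟩⟩]
  have hg0 : ∀ x, (g x).1 ≠ 0 := by decide
  have hginj : Function.Injective g := by decide
  have hgadj : ∀ x y : Fin 5, (g x).1 ≠ (g y).1 ↔ (x : ℕ) % 3 ≠ y % 3 := by decide
  let f : V → Σ i : Fin 4, Fin (![6, 2, 2, 1] i) := fun v ↦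
    if h : v ∈ A then ⟨0, eA ⟨v, h⟩⟩ else g (ψ ⟨v, by simpa using h⟩)
  have hfA : ∀ v (h : v ∈ A), f v = ⟨0, eA ⟨v, h⟩⟩ := fun v h ↦ dif_pos h
  have hfB : ∀ v (h : v ∉ A), f v = g (ψ ⟨v, by simpa using h⟩) := fun v h ↦ dif_neg h
  have hf : Function.Injective f := by
    intro x y hxy
    by_cases hx : x ∈ A <;> by_cases hy : y ∈ A
    · rw [hfA x hx, hfA y hy] at hxy
      have h := eq_of_heq (Sigma.mk.inj hxy).2
      exact congrArg Subtype.val (eA.injective h)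
    · rw [hfA x hx, hfB y hy] at hxy
      exact absurd (congrArg Sigma.fst hxy).symm (hg0 _)
    · rw [hfB x hx, hfA y hy] at hxy
      exact absurd (congrArg Sigma.fst hxy) (hg0 _)
    · rw [hfB x hx, hfB y hy] at hxy
      exact congrArg Subtype.val (ψ.injective (hginj hxy))
  have hbij : Function.Bijective f := by
    rw [Fintype.bijective_iff_injective_and_card]
    exact ⟨hf, by rw [hV]; rfl⟩
  refine ⟨⟨Equiv.ofBijective f hbij, ?_⟩⟩
  intro x y
  change (f x).1 ≠ (f y).1 ↔ G.Adj x y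
  by_cases hx : x ∈ A
  · by_cases hy : y ∈ A
    · rw [hadj x hx, hfA x hx, hfA y hy]
      simpa using hy
    · rw [hadj x hx, hfA x hx, hfB y hy]
      simpa [hy] using (hg0 _).symm
  · by_cases hy : y ∈ A
    · rw [G.adj_comm, hadj y hy, hfB x hx, hfA y hy]
      simpa [hx] using hg0 _
    · rw [hfB x hx, hfB y hy, hgadj, ← turanGraph_adj, ψ.map_adj_iff]
      rfl

end K6221

end SimpleGraph

/-! ### Assembly of the two statements -/

theorem mainTheorem4 {V : Type*} [Fintype V] [DecidableEq V] (G : SimpleGraph V)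
    [DecidableRel G.Adj] (n r k : ℕ) (hr : 3 ≤ r) (hn : Fintype.card V = n)
    (hG : G.CliqueFree (r + 1)) :
    ((if r = 3 then 6 * k + 26 else if r ≤ 7 then 5 * k + 11 else 2 * k + 9) ≤ n →
      (¬ G.IsPathHamiltonian k →
        G.edgeFinset.card ≤ (SimpleGraph.turanGraph (n - 1) r).edgeFinset.card + (k + 1)) ∧
      (G.IsTuranPlusTraceableVertex n r k →
        ¬ G.IsPathHamiltonian k ∧
        G.edgeFinset.card = (SimpleGraph.turanGraph (n - 1) r).edgeFinset.card + (k + 1))) ∧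
    ((if r = 3 then 6 * k + 26 else if r ≤ 7 then 6 * k + 2 * r + 3 else 2 * k + 2 * r) ≤ n →
      (¬ G.IsPathHamiltonian k →
        G.edgeFinset.card ≤ (SimpleGraph.turanGraph (n - 1) r).edgeFinset.card + (k + 1)) ∧
      ((¬ G.IsPathHamiltonian k ∧
        G.edgeFinset.card = (SimpleGraph.turanGraph (n - 1) r).edgeFinset.card + (k + 1)) ↔
        (G.IsTuranPlusTraceableVertex n r k ∨
          (Nonempty (G ≃g SimpleGraph.K6221) ∧ k = 0 ∧ r = 4 ∧ n = 11)))) := by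
  subst hn
  refine ⟨fun hn ↦ ⟨fun hk ↦ (hG.card_edgeFinset_le_of_not_isPathHamiltonian hr hk hn).1,
    fun h ↦ h.not_isPathHamiltonian_and_card ?_⟩, fun hn2 ↦ ?_⟩
  · split_ifs at hn <;> omega
  -- The thresholds of the second statement imply those of the first.
  have hn : (if r = 3 then 6 * k + 26 else if r ≤ 7 then 5 * k + 11 else 2 * k + 9) ≤
      Fintype.card V := by
    split_ifs at hn2 ⊢ <;> omega
  have hT : (SimpleGraph.turanGraph 10 4).edgeFinset.card = 37 := by
    rw [SimpleGraph.card_edgeFinset_turanGraph]; rfl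
  refine ⟨fun hk ↦ (hG.card_edgeFinset_le_of_not_isPathHamiltonian hr hk hn).1,
    fun ⟨hk, he⟩ ↦ ?_, ?_⟩
  · rcases (hG.card_edgeFinset_le_of_not_isPathHamiltonian hr hk hn).2 hn2 he with
      ⟨u, hu⟩ | ⟨rfl, rfl, h11, h6⟩
    · refine Or.inl (hG.isTuranPlusTraceableVertex hr hk ?_ he hu)
      split_ifs at hn2 <;> omega
    · rw [h11, hT] at he
      exact Or.inr ⟨hG.nonempty_iso_K6221 h11 he h6, rfl, rfl, h11⟩
  · rintro (h | ⟨⟨φ⟩, rfl, rfl, h11⟩)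
    · refine h.not_isPathHamiltonian_and_card ?_
      split_ifs at hn <;> omega
    · refine ⟨SimpleGraph.not_isPathHamiltonian_of_iso_K6221 φ, ?_⟩
      rw [h11, hT, φ.card_edgeFinset_eq, SimpleGraph.card_edgeFinset_K6221]
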